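/- Let $m>0$ and let $\mathcal M=\{(T,X)\in\mathbb R^2 : T^2-X^2<1\}\times S^2$ be the maximal Schwarzschild--Kruskal space-time of mass $m$, with metric $$g=\frac{32m^3}{r}\,e^{-r/2m}\,(-dT^2+dX^2)+r^2 g_{S^2},\qquad \Big(\frac{r}{2m}-1\Big)e^{r/2m}=X^2-T^2,\quad r>0 .$$ Its exterior regions are $\mathcal D_1=\{X>|T|\}$ and $\mathcal D_2=\{X<-|T|\}$; its event horizon is $\mathcal H=\mathcal H^+\cup\mathcal H^-$, where $\mathcal H^{\pm}=\{T=\pm|X|\}$, and its bifurcation sphere is $\Omega=\mathcal H^+\cap\mathcal H^-=\{T=X=0\}$. Let $\Sigma\subset\mathcal M$ be a connected analytic embedded hypersurface which is contained in $\mathcal D_1$ or in $\mathcal D_2$. Suppose that $\Sigma$ is time-symmetric, i.e. that it is space-like and its extrinsic curvature $K(U,V)=g(V,\nabla_U N)$ ($U,V$ tangent to $\Sigma$) vanishes identically, where $N$ is the unit time-like normal of $\Sigma$ and $\nabla$ the Levi-Civita connection of $g$. Then no point of $\mathcal H\setminus\Omega$ belongs to the (topological) boundary of $\Sigma$ in $\mathcal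 M$. -/

import Mathlib

open scoped Manifold ContDiff

/-! ### Pseudo-Riemannian geometry of maps into a submanifold of a vector space

`G p u v` is a field of symmetric bilinear forms on (an open part of) a normed space `E`. For a
submanifold `M ⊆ E` carrying the metric `g = G|_{TM}`, and for vectors `u`, vector fields `V` and
vectors `w`, all tangent to `M`, the Koszul formula for the Levi-Civita connection `∇` of `(M, g)`
reads `g(∇_u V, w) = G(dV(u), w) + Γ(u, V; w)`, where `Γ` are the Christoffel symbols of the first
kind of `G`: the component of `dV(u)` that is not tangent to `M` does not matter, because the
right-hand side is tested on tangent vectors `w` only. -/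

section Connection

variable {E : Type*} [NormedAddCommGroup E] [NormedSpace ℝ E]

/-- Christoffel symbols of the first kind,
`Γ(u, v; w) = (∂_u G(v, w) + ∂_v G(u, w) - ∂_w G(u, v)) / 2`, at the point `p`. -/
noncomputable def christoffel (G : E → E → E → ℝ) (p u v w : E) : ℝ :=
  (fderiv ℝ (fun q => G q v w) p u + fderiv ℝ (fun q => G q u w) p v
    - fderiv ℝ (fun q => G q u v) p w) / 2

variable {S : Type*} [TopologicalSpace S] [ChartedSpace (EuclideanSpace ℝ (Fin 3)) S]

/-- `g(∇_a V, w)`: covariant derivative of the vector field `V` along the map `f : S → E` in the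
direction `a ∈ T_x S`, tested against the vector `w`. -/
noncomputable def covDerivAlong (G : E → E → E → ℝ) (f V : S → E) (x : S)
    (a : TangentSpace (𝓡 3) x) (w : E) : ℝ :=
  G (f x) (mvfderiv (𝓡 3) V x a) w + christoffel G (f x) (mvfderiv (𝓡 3) f x a) (V x) w

/-- Extrinsic curvature `K(a, b) = g(e_b, ∇_{e_a} N)` of the hypersurface `f : S → E` with respect
to the normal field `N`, where `e_a = df(a)` and `e_b = df(b)`. -/
noncomputable def extrinsicCurvature (G : E → E → E → ℝ) (f N : S → E) (x : S)
    (a b : TangentSpace (𝓡 3) x) : ℝ :=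
  covDerivAlong G f N x a (mvfderiv (𝓡 3) f x b)

end Connection

/-! ### The Schwarzschild–Kruskal space-time of mass `m` -/

/-- The area radius `r` as a function of the Kruskal coordinates: the positive solution of
`(r / 2m - 1) exp (r / 2m) = X² - T²`. -/
noncomputable def kruskalRadius (m T X : ℝ) : ℝ :=
  Function.invFunOn (fun r : ℝ => (r / (2 * m) - 1) * Real.exp (r / (2 * m))) (Set.Ioi 0)
    (X ^ 2 - T ^ 2)

/-- For `m > 0` and `T² - X² < 1` the equation that defines `r` has a positive solution, so
`kruskalRadius` is one. -/
theorem kruskalRadius_spec {m T X : ℝ} (hm : 0 < m) (h : T ^ 2 - X ^ 2 < 1) :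
    0 < kruskalRadius m T X ∧
      (kruskalRadius m T X / (2 * m) - 1) * Real.exp (kruskalRadius m T X / (2 * m))
        = X ^ 2 - T ^ 2 := by
  have hex : ∃ r ∈ Set.Ioi (0 : ℝ),
      (fun r : ℝ => (r / (2 * m) - 1) * Real.exp (r / (2 * m))) r = X ^ 2 - T ^ 2 := by
    set F : ℝ → ℝ := fun s => (s - 1) * Real.exp s with hF
    have hc : ContinuousOn F (Set.Icc 0 (1 + X ^ 2)) := by
      apply Continuous.continuousOn
      fun_prop
    have h0 : F 0 < X ^ 2 - T ^ 2 := by simp [hF]; linarith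
    have h1 : X ^ 2 - T ^ 2 ≤ F (1 + X ^ 2) := by
      have he : 1 ≤ Real.exp (1 + X ^ 2) := Real.one_le_exp (by positivity)
      simp only [hF]
      nlinarith [sq_nonneg X, sq_nonneg T]
    obtain ⟨s, hs, hsy⟩ := intermediate_value_Icc (by positivity) hc ⟨h0.le, h1⟩
    have hs0 : 0 < s := by
      rcases hs.1.lt_or_eq with h' | h'
      · exact h'
      · rw [← h'] at hsy
        linarith
    refine ⟨2 * m * s, by simp only [Set.mem_Ioi]; positivity, ?_⟩
    have : 2 * m * s / (2 * m) = s := by field_simp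
    simpa [this, hF] using hsy
  exact Function.invFunOn_pos hex

/-- The positive solution of the equation that defines `r` is unique. -/
theorem kruskalRadius_unique {m T X r : ℝ} (hm : 0 < m) (h : T ^ 2 - X ^ 2 < 1) (hr : 0 < r)
    (hrX : (r / (2 * m) - 1) * Real.exp (r / (2 * m)) = X ^ 2 - T ^ 2) :
    kruskalRadius m T X = r := by
  have key : ∀ s t : ℝ, 0 < s → s < t → (s - 1) * Real.exp s < (t - 1) * Real.exp t := by
    intro s t hs hst
    have h1 : Real.exp t = Real.exp s * Real.exp (t - s) := by rw [← Real.exp_add]; ring_nf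
    have h2 : (1 - (t - s)) ≤ Real.exp (-(t - s)) := by
      have := Real.add_one_le_exp (-(t - s)); linarith
    have h3 : t - s + 1 < Real.exp (t - s) := Real.add_one_lt_exp (by linarith)
    have h4 : (s - 1) < (t - 1) * Real.exp (t - s) := by
      rcases le_or_gt 1 t with ht | ht
      · nlinarith
      · have h5 : Real.exp (-(t - s)) * Real.exp (t - s) = 1 := by
          rw [← Real.exp_add]; simp
        have h6 : (1 - (t - s)) * Real.exp (t - s) ≤ 1 := by
          have := mul_le_mul_of_nonneg_right h2 (Real.exp_pos (t - s)).le
          linarith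
        have h7 : s * 1 < s * Real.exp (t - s) := mul_lt_mul_of_pos_left (by linarith) hs
        nlinarith
    rw [h1]
    nlinarith [Real.exp_pos s]
  obtain ⟨hp, he⟩ := kruskalRadius_spec hm h
  have h2m : (0 : ℝ) < 2 * m := by positivity
  rcases lt_trichotomy (kruskalRadius m T X) r with hlt | heq | hgt
  · have := key _ _ (div_pos hp h2m) (div_lt_div_of_pos_right hlt h2m)
    linarith
  · exact heq
  · have := key _ _ (div_pos hr h2m) (div_lt_div_of_pos_right hgt h2m)
    linarith

namespace Kruskal

/-- The vector space `ℝ_T × ℝ_X × ℝ³` that contains the Kruskal manifold. -/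
abbrev Ambient : Type := ℝ × ℝ × EuclideanSpace ℝ (Fin 3)

/-- The maximal Schwarzschild–Kruskal manifold `{(T, X) : T² - X² < 1} × S²`, with the subspace
topology; it is a submanifold of `Ambient`, with `S²` the unit sphere of `ℝ³`. -/
abbrev Spacetime : Type := {p : Ambient // p.1 ^ 2 - p.2.1 ^ 2 < 1 ∧ ‖p.2.2‖ = 1}

/-- The vector `v` of the ambient space is tangent to the Kruskal manifold at `p`. -/
def IsTangent (p v : Ambient) : Prop := inner ℝ p.2.2 v.2.2 = 0

/-- The Kruskal metric of mass `m`,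
`g = (32 m³ / r) exp (-r / 2m) (-dT² + dX²) + r² (round metric of S²)`, as the restriction to the
tangent vectors of the Kruskal manifold of a field of bilinear forms on the ambient space. -/
noncomputable def metric (m : ℝ) (p u v : Ambient) : ℝ :=
  32 * m ^ 3 / kruskalRadius m p.1 p.2.1 * Real.exp (-(kruskalRadius m p.1 p.2.1) / (2 * m))
      * (-(u.1 * v.1) + u.2.1 * v.2.1)
    + kruskalRadius m p.1 p.2.1 ^ 2 * inner ℝ u.2.2 v.2.2

/-- The static exterior region `D₁`. -/
def exterior₁ : Set Spacetime := {p | |p.1.1| < p.1.2.1}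

/-- The static exterior region `D₂`. -/
def exterior₂ : Set Spacetime := {p | p.1.2.1 < -|p.1.1|}

/-- The future event horizon `H⁺`, the boundary of the future black hole region `|X| < T`. -/
def futureHorizon : Set Spacetime := {p | p.1.1 = |p.1.2.1|}

/-- The past event horizon `H⁻`, the boundary of the past black hole region `T < -|X|`. -/
def pastHorizon : Set Spacetime := {p | p.1.1 = -|p.1.2.1|}

/-- The event horizon `H = H⁺ ∪ H⁻`. -/
def eventHorizon : Set Spacetime := futureHorizon ∪ pastHorizon

/-- The bifurcation sphere `Ω = H⁺ ∩ H⁻`. -/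
def bifurcationSphere : Set Spacetime := futureHorizon ∩ pastHorizon

section Hypersurface

variable {S : Type*} [TopologicalSpace S] [ChartedSpace (EuclideanSpace ℝ (Fin 3)) S]

/-- The map `ι` from the analytic 3-manifold `S` into the Kruskal manifold is an analytic embedding.
(As the Kruskal manifold is an embedded analytic submanifold of the ambient space, this can be
tested in the ambient space.) -/
def IsAnalyticEmbedding (ι : S → Spacetime) : Prop :=
  Manifold.IsSmoothEmbedding (𝓡 3) 𝓘(ℝ, Ambient) ω (fun x => (ι x : Ambient))

/-- The hypersurface `ι` is space-like: its first fundamental form is positive definite. -/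
def IsSpacelike (m : ℝ) (ι : S → Spacetime) : Prop :=
  ∀ (x : S) (a : TangentSpace (𝓡 3) x), a ≠ 0 →
    0 < metric m (ι x) (mvfderiv (𝓡 3) (fun y => (ι y : Ambient)) x a)
      (mvfderiv (𝓡 3) (fun y => (ι y : Ambient)) x a)

/-- `N` is an analytic field of unit time-like normals (`g(N, N) = -1`) of the hypersurface `ι`. -/
structure IsUnitNormal (m : ℝ) (ι : S → Spacetime) (N : S → Ambient) : Prop where
  analytic : ContMDiff (𝓡 3) 𝓘(ℝ, Ambient) ω N
  tangent : ∀ x, IsTangent (ι x) (N x)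
  unit : ∀ x, metric m (ι x) (N x) (N x) = -1
  normal : ∀ (x : S) (a : TangentSpace (𝓡 3) x),
    metric m (ι x) (N x) (mvfderiv (𝓡 3) (fun y => (ι y : Ambient)) x a) = 0

/-- The hypersurface `ι` is time-symmetric: it is space-like and its extrinsic curvature vanishes
identically. (The space-time is time-oriented, so a space-like analytic hypersurface always has a
global unit normal field, unique up to sign on connected hypersurfaces, and it is analytic.) -/
def IsTimeSymmetric (m : ℝ) (ι : S → Spacetime) : Prop :=
  IsSpacelike m ι ∧ ∃ N : S → Ambient, IsUnitNormal m ι N ∧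
    ∀ (x : S) (a b : TangentSpace (𝓡 3) x),
      extrinsicCurvature (metric m) (fun y => (ι y : Ambient)) N x a b = 0

end Hypersurface

end Kruskal

open Filter Topology

/-! Vanishing extrinsic curvature together with `g(N, N) = -1` makes the unit normal `N` parallel
along the hypersurface. Let `y` be the position on the sphere, `n` the angular part of `N`, and `f =
dr(N)`. Testing `∇N = 0` on angular vectors gives `d(r n) = -f dy - ⟨r n, dy⟩ y`
(`fderiv_radius_smul_normal`). Testing it on the gradient of `r`, that is, evaluating the Hessian of
`r` on `N` and a tangent vector, gives `df = (r - 3m) ⟨n, dy⟩` (`fderiv_normalRadiusDeriv`).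

The second derivative of `r n` is symmetric, and this integrability condition reads `3m (⟨n, dy(a)⟩
dy(b) - ⟨n, dy(b)⟩ dy(a)) = 0` (`inner_smul_comm`). Since `dy` maps onto the tangent plane of the
sphere, `n = 0`; the first equation then gives `f dy = 0`, so `f = 0`. Thus `N` has no angular part
and annihilates `r`, and orthogonality to `N` becomes `X dT = T dX`.

Where `X ≠ 0`, the quotient `T / X` is therefore locally constant, so the connected hypersurface
lies in a slice `T = c X`, with `|c| < 1` in an exterior region. That slice is closed and meets `|T|
= |X|` only where `T = X = 0`. -/

/-! ### The area radius as an inverse function. -/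

/-- The function `r` of `X² - T²` through which the area radius is defined. -/
noncomputable def areaRadius (m : ℝ) : ℝ → ℝ :=
  Function.invFunOn (fun r : ℝ => (r / (2 * m) - 1) * Real.exp (r / (2 * m))) (Set.Ioi 0)

theorem kruskalRadius_eq_areaRadius (m T X : ℝ) :
    kruskalRadius m T X = areaRadius m (X ^ 2 - T ^ 2) := rfl

theorem areaRadius_apply {m r : ℝ} (hm : 0 < m) (hr : 0 < r) :
    areaRadius m ((r / (2 * m) - 1) * Real.exp (r / (2 * m))) = r := by
  set y := (r / (2 * m) - 1) * Real.exp (r / (2 * m)) with hy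
  have hs : 0 < r / (2 * m) := by positivity
  have h1 : -1 < y := by
    have h2 : 1 - r / (2 * m) < Real.exp (-(r / (2 * m))) := by
      have := Real.add_one_lt_exp (neg_ne_zero.2 hs.ne')
      linarith
    have h3 := mul_lt_mul_of_pos_right h2 (Real.exp_pos (r / (2 * m)))
    rw [← Real.exp_add, neg_add_cancel, Real.exp_zero] at h3
    linarith
  -- Uniqueness is available only for values of the form `X² - T²`; `T = 1`, `X = √(y + 1)` realises
  -- `y`.
  have h4 : Real.sqrt (y + 1) ^ 2 = y + 1 := Real.sq_sqrt (by linarith)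
  have h5 := kruskalRadius_unique (m := m) (T := 1) (X := Real.sqrt (y + 1)) hm
    (by rw [h4]; linarith) hr (by rw [h4, ← hy]; ring)
  rw [kruskalRadius_eq_areaRadius, h4] at h5
  simpa using h5

/-- The defining function of `r` has a nonzero strict derivative at every positive radius, so the
derivative of its left inverse is the reciprocal. -/
theorem hasDerivAt_areaRadius {m r : ℝ} (hm : 0 < m) (hr : 0 < r) :
    HasDerivAt (areaRadius m) (4 * m ^ 2 / r * Real.exp (-r / (2 * m)))
      ((r / (2 * m) - 1) * Real.exp (r / (2 * m))) := by
  have hs : HasStrictDerivAt (fun r : ℝ => r / (2 * m)) (1 / (2 * m)) r :=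
    (hasStrictDerivAt_id r).div_const _
  have hF : HasStrictDerivAt (fun r : ℝ => (r / (2 * m) - 1) * Real.exp (r / (2 * m)))
      (r / (4 * m ^ 2) * Real.exp (r / (2 * m))) r := by
    have hs1 : HasStrictDerivAt (fun r : ℝ => r / (2 * m) - 1) (1 / (2 * m)) r := hs.sub_const 1
    refine (hs1.mul hs.exp).congr_deriv ?_
    field_simp
    ring
  have hne : r / (4 * m ^ 2) * Real.exp (r / (2 * m)) ≠ 0 := by positivity
  have hinv := hF.to_local_left_inverse hne (g := areaRadius m)
    (by filter_upwards [lt_mem_nhds hr] with s hs using areaRadius_apply hm hs)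
  refine hinv.hasDerivAt.congr_deriv ?_
  rw [neg_div, Real.exp_neg]
  field_simp

theorem EuclideanSpace.exists_ne_zero_inner_eq_zero (u v : EuclideanSpace ℝ (Fin 3)) :
    ∃ w : EuclideanSpace ℝ (Fin 3), w ≠ 0 ∧ inner ℝ u w = 0 ∧ inner ℝ v w = 0 := by
  have hlt : Submodule.span ℝ ((({u, v} : Finset (EuclideanSpace ℝ (Fin 3))) :
      Set (EuclideanSpace ℝ (Fin 3)))) ≠ ⊤ := by
    intro h
    have h1 := finrank_span_finset_le_card (R := ℝ) ({u, v} : Finset (EuclideanSpace ℝ (Fin 3)))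
    have h2 : Finset.card ({u, v} : Finset (EuclideanSpace ℝ (Fin 3))) ≤ 2 := Finset.card_le_two
    rw [Set.finrank, h, finrank_top] at h1
    simp at h1
    omega
  rw [Ne, ← Submodule.orthogonal_eq_bot_iff, Submodule.eq_bot_iff] at hlt
  push Not at hlt
  obtain ⟨w, hw, hw0⟩ := hlt
  rw [Submodule.mem_orthogonal] at hw
  exact ⟨w, hw0, hw u (Submodule.subset_span (by simp)), hw v (Submodule.subset_span (by simp))⟩

namespace Kruskal

/-! ### First derivatives of the metric coefficients. -/

/-- The conformal factor `(32 m³ / r) exp (-r / 2m)` of the metric. -/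
noncomputable def conformalFactor (m T X : ℝ) : ℝ :=
  32 * m ^ 3 / kruskalRadius m T X * Real.exp (-(kruskalRadius m T X) / (2 * m))

theorem metric_eq (m : ℝ) (p u v : Ambient) :
    metric m p u v = conformalFactor m p.1 p.2.1 * (-(u.1 * v.1) + u.2.1 * v.2.1)
      + kruskalRadius m p.1 p.2.1 ^ 2 * inner ℝ u.2.2 v.2.2 := rfl

theorem conformalFactor_pos {m T X : ℝ} (hm : 0 < m) (h : T ^ 2 - X ^ 2 < 1) :
    0 < conformalFactor m T X := by
  have := (kruskalRadius_spec hm h).1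
  unfold conformalFactor
  positivity

/-- This is `|∇r|² = 1 - 2m/r` cleared of denominators; the mass enters the Hessian of `r` through
it. -/
theorem conformalFactor_mul {m T X : ℝ} (hm : 0 < m) (h : T ^ 2 - X ^ 2 < 1) :
    conformalFactor m T X * (X ^ 2 - T ^ 2) * kruskalRadius m T X
      = 16 * m ^ 2 * (kruskalRadius m T X - 2 * m) := by
  obtain ⟨h1, h2⟩ := kruskalRadius_spec hm h
  rw [← h2, conformalFactor, neg_div, Real.exp_neg]
  field_simp
  ring

/-- The directional derivative of the area radius. -/
noncomputable def radiusDeriv (m T X T' X' : ℝ) : ℝ :=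
  conformalFactor m T X / (4 * m) * (X * X' - T * T')

/-- The directional derivative of the conformal factor. -/
noncomputable def conformalDeriv (m T X T' X' : ℝ) : ℝ :=
  -(conformalFactor m T X * (1 / kruskalRadius m T X + 1 / (2 * m)) * radiusDeriv m T X T' X')

theorem _root_.HasDerivAt.kruskalRadius {m : ℝ} (hm : 0 < m) {T X : ℝ → ℝ} {T' X' t : ℝ}
    (hT : HasDerivAt T T' t) (hX : HasDerivAt X X' t) (h : T t ^ 2 - X t ^ 2 < 1) :
    HasDerivAt (fun s => kruskalRadius m (T s) (X s)) (radiusDeriv m (T t) (X t) T' X') t := by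
  obtain ⟨h1, h2⟩ := kruskalRadius_spec hm h
  have hR := hasDerivAt_areaRadius hm h1
  rw [h2] at hR
  refine (hR.comp t ((hX.pow 2).sub (hT.pow 2))).congr_deriv ?_
  simp only [radiusDeriv, conformalFactor]
  field_simp
  ring

theorem _root_.HasDerivAt.conformalFactor {m : ℝ} (hm : 0 < m) {T X : ℝ → ℝ} {T' X' t : ℝ}
    (hT : HasDerivAt T T' t) (hX : HasDerivAt X X' t) (h : T t ^ 2 - X t ^ 2 < 1) :
    HasDerivAt (fun s => conformalFactor m (T s) (X s)) (conformalDeriv m (T t) (X t) T' X') t := by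
  obtain ⟨h1, h2⟩ := kruskalRadius_spec hm h
  have hR := hT.kruskalRadius hm hX h
  refine (((hasDerivAt_const t (32 * m ^ 3)).div hR h1.ne').mul
    ((hR.neg.div_const (2 * m)).exp)).congr_deriv ?_
  simp only [conformalDeriv, Kruskal.conformalFactor, Pi.neg_apply, Pi.div_apply]
  field_simp
  ring

theorem differentiableAt_kruskalRadius {m : ℝ} (hm : 0 < m) {p : ℝ × ℝ}
    (h : p.1 ^ 2 - p.2 ^ 2 < 1) :
    DifferentiableAt ℝ (fun q : ℝ × ℝ => kruskalRadius m q.1 q.2) p := by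
  obtain ⟨h1, h2⟩ := kruskalRadius_spec hm h
  have hR := (hasDerivAt_areaRadius hm h1).differentiableAt
  rw [h2] at hR
  exact hR.comp (f := fun q : ℝ × ℝ => q.2 ^ 2 - q.1 ^ 2) p (by fun_prop)

theorem _root_.DifferentiableAt.kruskalRadius {W : Type*} [NormedAddCommGroup W] [NormedSpace ℝ W]
    {m : ℝ} (hm : 0 < m) {T X : W → ℝ} {z : W} (hT : DifferentiableAt ℝ T z)
    (hX : DifferentiableAt ℝ X z) (h : T z ^ 2 - X z ^ 2 < 1) :
    DifferentiableAt ℝ (fun s => kruskalRadius m (T s) (X s)) z :=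
  DifferentiableAt.comp (g := fun q : ℝ × ℝ => _root_.kruskalRadius m q.1 q.2)
    (f := fun s => (T s, X s)) z (differentiableAt_kruskalRadius hm h) (hT.prodMk hX)

theorem _root_.DifferentiableAt.conformalFactor {W : Type*} [NormedAddCommGroup W]
    [NormedSpace ℝ W] {m : ℝ} (hm : 0 < m) {T X : W → ℝ} {z : W} (hT : DifferentiableAt ℝ T z)
    (hX : DifferentiableAt ℝ X z) (h : T z ^ 2 - X z ^ 2 < 1) :
    DifferentiableAt ℝ (fun s => conformalFactor m (T s) (X s)) z := by
  have hR := hT.kruskalRadius hm hX h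
  have h1 := (kruskalRadius_spec hm h).1.ne'
  unfold Kruskal.conformalFactor
  fun_prop (disch := assumption)

/-- The derivative of the coefficients of the metric. -/
theorem fderiv_metric {m : ℝ} (hm : 0 < m) {p : Ambient} (h : p.1 ^ 2 - p.2.1 ^ 2 < 1)
    (u v w : Ambient) :
    fderiv ℝ (fun q => metric m q u v) p w
      = conformalDeriv m p.1 p.2.1 w.1 w.2.1 * (-(u.1 * v.1) + u.2.1 * v.2.1)
        + 2 * kruskalRadius m p.1 p.2.1 * radiusDeriv m p.1 p.2.1 w.1 w.2.1
          * inner ℝ u.2.2 v.2.2 := by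
  have hd : DifferentiableAt ℝ (fun q => metric m q u v) p := by
    have h1 : DifferentiableAt ℝ (fun q : Ambient => kruskalRadius m q.1 q.2.1) p :=
      DifferentiableAt.kruskalRadius hm (by fun_prop) (by fun_prop) h
    have h2 : DifferentiableAt ℝ (fun q : Ambient => conformalFactor m q.1 q.2.1) p :=
      DifferentiableAt.conformalFactor hm (by fun_prop) (by fun_prop) h
    simp only [metric_eq]
    fun_prop
  -- Restriction to the line `p + t w` reduces the claim to the one-variable derivatives of `r` and
  -- of the conformal factor.
  have hl : HasDerivAt (fun t : ℝ => p + t • w) w 0 := by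
    simpa using ((hasDerivAt_id (0 : ℝ)).smul_const w).const_add p
  have hd' : DifferentiableAt ℝ (fun q => metric m q u v) ((fun t : ℝ => p + t • w) 0) := by
    simpa using hd
  have hc := hd'.hasFDerivAt.comp_hasDerivAt (0 : ℝ) hl
  have hT : HasDerivAt (fun t : ℝ => (p + t • w).1) w.1 0 := by
    exact (ContinuousLinearMap.fst ℝ ℝ _).hasFDerivAt.comp_hasDerivAt 0 hl
  have hX : HasDerivAt (fun t : ℝ => (p + t • w).2.1) w.2.1 0 := by
    exact ((ContinuousLinearMap.fst ℝ ℝ _).comp (ContinuousLinearMap.snd ℝ ℝ _)).hasFDerivAt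
      |>.comp_hasDerivAt 0 hl
  have h0 : (p + (0 : ℝ) • w).1 ^ 2 - (p + (0 : ℝ) • w).2.1 ^ 2 < 1 := by simpa using h
  have he := (((hT.conformalFactor hm hX h0).mul_const (-(u.1 * v.1) + u.2.1 * v.2.1)).add
    (((hT.kruskalRadius hm hX h0).pow 2).mul_const (inner ℝ u.2.2 v.2.2)))
  have := hc.unique he
  simp only [zero_smul, add_zero] at this
  rw [this]
  simp


theorem christoffel_metric {m : ℝ} (hm : 0 < m) {p : Ambient} (h : p.1 ^ 2 - p.2.1 ^ 2 < 1)
    (u v w : Ambient) :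
    christoffel (metric m) p u v w =
      ((conformalDeriv m p.1 p.2.1 u.1 u.2.1 * (-(v.1 * w.1) + v.2.1 * w.2.1)
        + 2 * kruskalRadius m p.1 p.2.1 * radiusDeriv m p.1 p.2.1 u.1 u.2.1
          * inner ℝ v.2.2 w.2.2)
      + (conformalDeriv m p.1 p.2.1 v.1 v.2.1 * (-(u.1 * w.1) + u.2.1 * w.2.1)
        + 2 * kruskalRadius m p.1 p.2.1 * radiusDeriv m p.1 p.2.1 v.1 v.2.1
          * inner ℝ u.2.2 w.2.2)
      - (conformalDeriv m p.1 p.2.1 w.1 w.2.1 * (-(u.1 * v.1) + u.2.1 * v.2.1)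
        + 2 * kruskalRadius m p.1 p.2.1 * radiusDeriv m p.1 p.2.1 w.1 w.2.1
          * inner ℝ u.2.2 v.2.2)) / 2 := by
  simp only [christoffel, fderiv_metric hm h]

/-! ### Totally geodesic immersions in a chart. -/

/-- The map `φ` from the open set `U` to the Kruskal manifold is a space-like immersion with
vanishing extrinsic curvature with respect to the unit normal field `N`. -/
structure IsTotallyGeodesicOn {W : Type*} [NormedAddCommGroup W] [NormedSpace ℝ W] (m : ℝ)
    (φ N : W → Ambient) (U : Set W) : Prop where
  isOpen : IsOpen U
  smooth : ContDiffOn ℝ 2 φ U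
  smooth_normal : ContDiffOn ℝ 1 N U
  mem_base : ∀ z ∈ U, (φ z).1 ^ 2 - (φ z).2.1 ^ 2 < 1
  mem_sphere : ∀ z ∈ U, ‖(φ z).2.2‖ = 1
  tangent : ∀ z ∈ U, IsTangent (φ z) (N z)
  unit : ∀ z ∈ U, metric m (φ z) (N z) (N z) = -1
  normal : ∀ z ∈ U, ∀ a, metric m (φ z) (N z) (fderiv ℝ φ z a) = 0
  spacelike : ∀ z ∈ U, ∀ a ≠ 0, 0 < metric m (φ z) (fderiv ℝ φ z a) (fderiv ℝ φ z a)
  curvature : ∀ z ∈ U, ∀ a b, metric m (φ z) (fderiv ℝ N z a) (fderiv ℝ φ z b)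
    + christoffel (metric m) (φ z) (fderiv ℝ φ z a) (N z) (fderiv ℝ φ z b) = 0

namespace IsTotallyGeodesicOn

variable {W : Type*} [NormedAddCommGroup W] [NormedSpace ℝ W] {m : ℝ} {φ N : W → Ambient}
  {U : Set W} {z : W}

theorem differentiableAt (h : IsTotallyGeodesicOn m φ N U) (hz : z ∈ U) :
    DifferentiableAt ℝ φ z :=
  (h.smooth.contDiffAt (h.isOpen.mem_nhds hz)).differentiableAt (by norm_num)

theorem differentiableAt_normal (h : IsTotallyGeodesicOn m φ N U) (hz : z ∈ U) :
    DifferentiableAt ℝ N z :=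
  (h.smooth_normal.contDiffAt (h.isOpen.mem_nhds hz)).differentiableAt (by norm_num)

theorem differentiableAt_fderiv (h : IsTotallyGeodesicOn m φ N U) (hz : z ∈ U) :
    DifferentiableAt ℝ (fderiv ℝ φ) z :=
  ((h.smooth.contDiffAt (h.isOpen.mem_nhds hz)).fderiv_right (m := 1)
    (by norm_num)).differentiableAt (by norm_num)

theorem _root_.hasDerivAt_comp_line {F : Type*} [NormedAddCommGroup F] [NormedSpace ℝ F] {f : W → F}
    (hf : DifferentiableAt ℝ f z) (a : W) :
    HasDerivAt (fun t : ℝ => f (z + t • a)) (fderiv ℝ f z a) 0 := by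
  have hl : HasDerivAt (fun t : ℝ => z + t • a) a 0 := by
    simpa using ((hasDerivAt_id (0 : ℝ)).smul_const a).const_add z
  have hf' : DifferentiableAt ℝ f ((fun t : ℝ => z + t • a) 0) := by simpa using hf
  have := hf'.hasFDerivAt.comp_hasDerivAt (0 : ℝ) hl
  simp only [zero_smul, add_zero] at this
  exact this

theorem _root_.HasDerivAt.prod_fst {F G : Type*} [NormedAddCommGroup F] [NormedSpace ℝ F]
    [NormedAddCommGroup G] [NormedSpace ℝ G] {f : ℝ → F × G} {f' : F × G} {t : ℝ}
    (hf : HasDerivAt f f' t) : HasDerivAt (fun s => (f s).1) f'.1 t :=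
  (ContinuousLinearMap.fst ℝ F G).hasFDerivAt.comp_hasDerivAt t hf

theorem _root_.HasDerivAt.prod_snd {F G : Type*} [NormedAddCommGroup F] [NormedSpace ℝ F]
    [NormedAddCommGroup G] [NormedSpace ℝ G] {f : ℝ → F × G} {f' : F × G} {t : ℝ}
    (hf : HasDerivAt f f' t) : HasDerivAt (fun s => (f s).2) f'.2 t :=
  (ContinuousLinearMap.snd ℝ F G).hasFDerivAt.comp_hasDerivAt t hf

/-- A function that vanishes near `z` has vanishing derivative along lines through `z`. -/
theorem deriv_line_eq_zero (h : IsTotallyGeodesicOn m φ N U) (hz : z ∈ U) {a : W} {f : W → ℝ}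
    {c f' : ℝ} (hf : ∀ x ∈ U, f x = c) (hd : HasDerivAt (fun t : ℝ => f (z + t • a)) f' 0) :
    f' = 0 := by
  have hl : ContinuousAt (fun t : ℝ => z + t • a) 0 := by fun_prop
  have : (fun t : ℝ => f (z + t • a)) =ᶠ[𝓝 0] fun _ => c := by
    have h0 := hl.preimage_mem_nhds (t := U) (by simpa using h.isOpen.mem_nhds hz)
    filter_upwards [h0] with t ht using hf _ ht
  exact hd.unique ((hasDerivAt_const (0 : ℝ) c).congr_of_eventuallyEq this)

theorem inner_deriv (h : IsTotallyGeodesicOn m φ N U) (hz : z ∈ U) (a : W) :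
    inner ℝ (φ z).2.2 (fderiv ℝ φ z a).2.2 = 0 := by
  have hd := (hasDerivAt_comp_line (h.differentiableAt hz) a).prod_snd.prod_snd
  have h1 := h.deriv_line_eq_zero (f := fun x => inner ℝ (φ x).2.2 (φ x).2.2) (c := 1) hz
    (fun x hx => by rw [real_inner_self_eq_norm_sq, h.mem_sphere x hx]; norm_num)
    (hd.inner ℝ hd)
  simp only [zero_smul, add_zero] at h1
  rw [real_inner_comm (φ z).2.2 (fderiv ℝ φ z a).2.2] at h1
  linarith

theorem inner_deriv_normal (h : IsTotallyGeodesicOn m φ N U) (hz : z ∈ U) (a : W) :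
    inner ℝ (φ z).2.2 (fderiv ℝ N z a).2.2 = -inner ℝ (N z).2.2 (fderiv ℝ φ z a).2.2 := by
  have hd := (hasDerivAt_comp_line (h.differentiableAt hz) a).prod_snd.prod_snd
  have hn := (hasDerivAt_comp_line (h.differentiableAt_normal hz) a).prod_snd.prod_snd
  have h1 := h.deriv_line_eq_zero (f := fun x => inner ℝ (φ x).2.2 (N x).2.2) (c := 0) hz
    (fun x hx => h.tangent x hx) (hd.inner ℝ hn)
  simp only [zero_smul, add_zero] at h1
  rw [real_inner_comm (fderiv ℝ φ z a).2.2 (N z).2.2]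
  linarith

/-- This is half the derivative of `g(N, N) = -1`: in `Γ(u, N; N)` the last two terms cancel,
leaving half of `∂_u G(N, N)`. It supplies the normal component of `∇N = 0`. -/
theorem curvature_normal (h : IsTotallyGeodesicOn m φ N U) (hm : 0 < m) (hz : z ∈ U) (a : W) :
    metric m (φ z) (fderiv ℝ N z a) (N z)
      + christoffel (metric m) (φ z) (fderiv ℝ φ z a) (N z) (N z) = 0 := by
  have hd := hasDerivAt_comp_line (h.differentiableAt hz) a
  have hn := hasDerivAt_comp_line (h.differentiableAt_normal hz) a
  have hb : (φ (z + (0 : ℝ) • a)).1 ^ 2 - (φ (z + (0 : ℝ) • a)).2.1 ^ 2 < 1 := by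
    simpa using h.mem_base z hz
  have h1 := h.deriv_line_eq_zero (f := fun x => metric m (φ x) (N x) (N x)) (c := -1) hz
    (fun x hx => h.unit x hx)
    (((hd.prod_fst.conformalFactor hm hd.prod_snd.prod_fst hb).mul
      (((hn.prod_fst.mul hn.prod_fst).neg).add (hn.prod_snd.prod_fst.mul hn.prod_snd.prod_fst))).add
      (((hd.prod_fst.kruskalRadius hm hd.prod_snd.prod_fst hb).pow 2).mul
        (hn.prod_snd.prod_snd.inner ℝ hn.prod_snd.prod_snd)))
  rw [christoffel_metric hm (h.mem_base z hz), metric_eq]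
  simp only [zero_smul, add_zero, Pi.add_apply, Pi.neg_apply, Pi.mul_apply, Pi.pow_apply] at h1
  have h2 := real_inner_comm (N z).2.2 (fderiv ℝ N z a).2.2
  rw [h2] at h1 ⊢
  linear_combination h1 / 2

/-- The derivative of the area radius in the direction of the normal. -/
noncomputable def normalRadiusDeriv (m : ℝ) (φ N : W → Ambient) (z : W) : ℝ :=
  radiusDeriv m (φ z).1 (φ z).2.1 (N z).1 (N z).2.1

/-- The area radius along the immersion. -/
noncomputable def radiusAlong (m : ℝ) (φ : W → Ambient) (z : W) : ℝ :=
  kruskalRadius m (φ z).1 (φ z).2.1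

theorem radiusAlong_pos (h : IsTotallyGeodesicOn m φ N U) (hm : 0 < m) (hz : z ∈ U) :
    0 < radiusAlong m φ z := (kruskalRadius_spec hm (h.mem_base z hz)).1

theorem differentiableAt_radiusAlong (h : IsTotallyGeodesicOn m φ N U) (hm : 0 < m) (hz : z ∈ U) :
    DifferentiableAt ℝ (radiusAlong m φ) z := by
  have := h.differentiableAt hz
  exact DifferentiableAt.kruskalRadius hm this.fst this.snd.fst (h.mem_base z hz)

theorem differentiableAt_normalRadiusDeriv (h : IsTotallyGeodesicOn m φ N U) (hm : 0 < m)
    (hz : z ∈ U) : DifferentiableAt ℝ (normalRadiusDeriv m φ N) z := by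
  have h1 := h.differentiableAt hz
  have h2 := h.differentiableAt_normal hz
  have h3 := DifferentiableAt.conformalFactor hm h1.fst h1.snd.fst (h.mem_base z hz)
  have h4 := h1.fst
  have h5 := h1.snd.fst
  have h6 := h2.fst
  have h7 := h2.snd.fst
  unfold normalRadiusDeriv radiusDeriv
  simp only [div_eq_mul_inv]
  fun_prop

/-- The metric is nonnegative on vectors without `T`-component, whereas `g(N, N) = -1`. -/
theorem normal_fst_ne_zero (h : IsTotallyGeodesicOn m φ N U) (hm : 0 < m) (hz : z ∈ U) :
    (N z).1 ≠ 0 := by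
  intro h0
  have h1 := h.unit z hz
  have hA := conformalFactor_pos hm (h.mem_base z hz)
  rw [metric_eq, h0, real_inner_self_eq_norm_sq] at h1
  have : 0 ≤ conformalFactor m (φ z).1 (φ z).2.1 * (-(0 * 0) + (N z).2.1 * (N z).2.1)
      + kruskalRadius m (φ z).1 (φ z).2.1 ^ 2 * ‖(N z).2.2‖ ^ 2 := by
    have := mul_self_nonneg (N z).2.1
    simp only [mul_zero, neg_zero, zero_add]
    positivity
  linarith

variable [FiniteDimensional ℝ W]

/-- The tangent vectors of the immersion and the normal span the tangent space of the Kruskal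
manifold. -/
theorem exists_eq_add (h : IsTotallyGeodesicOn m φ N U) (hW : Module.finrank ℝ W = 3) (hz : z ∈ U)
    {w : Ambient} (hw : IsTangent (φ z) w) :
    ∃ (a : W) (c : ℝ), w = fderiv ℝ φ z a + c • N z := by
  -- Adjoining the radial direction of `ℝ³` makes both sides five-dimensional, so injectivity yields
  -- surjectivity; tangency of `w` then kills the radial coefficient.
  let L : W × ℝ × ℝ →ₗ[ℝ] Ambient :=
    { toFun := fun x => fderiv ℝ φ z x.1 + x.2.1 • N z + x.2.2 • ((0, 0, (φ z).2.2) : Ambient)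
      map_add' := by intro x y; simp only [Prod.fst_add, Prod.snd_add, map_add, add_smul]; abel
      map_smul' := by
        intro c x
        simp only [Prod.smul_fst, Prod.smul_snd, map_smul, smul_add, smul_smul, smul_eq_mul,
          RingHom.id_apply] }
  have hy : inner ℝ (φ z).2.2 (φ z).2.2 = (1 : ℝ) := by
    rw [real_inner_self_eq_norm_sq, h.mem_sphere z hz]; norm_num
  have hL : ∀ x, inner ℝ (φ z).2.2 (L x).2.2 = x.2.2 := by
    intro x
    have := h.tangent z hz
    simp only [IsTangent] at this
    simp [L, inner_add_right, inner_smul_right, h.inner_deriv hz, this, h.mem_sphere z hz]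
  have hNL : ∀ a c, metric m (φ z) (N z) (fderiv ℝ φ z a + c • N z) = -c := by
    intro a c
    have h1 := h.unit z hz
    have h2 := h.normal z hz a
    simp only [metric_eq, Prod.fst_add, Prod.snd_add, Prod.smul_fst, Prod.smul_snd,
      inner_add_right, inner_smul_right, smul_eq_mul] at h1 h2 ⊢
    linear_combination h2 + c * h1
  have hinj : Function.Injective L := by
    rw [← LinearMap.ker_eq_bot, LinearMap.ker_eq_bot']
    rintro ⟨a, c, d⟩ h0
    have hd : d = 0 := by simpa [h0] using (hL (a, c, d)).symm
    have h1 : fderiv ℝ φ z a + c • N z = 0 := by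
      rw [hd] at h0
      change fderiv ℝ φ z a + c • N z + (0 : ℝ) • ((0, 0, (φ z).2.2) : Ambient) = 0 at h0
      rwa [zero_smul, add_zero] at h0
    have hc : c = 0 := by
      have := hNL a c
      rw [h1] at this
      simpa [metric_eq] using this
    have ha : a = 0 := by
      by_contra ha
      have h2 := h.spacelike z hz a ha
      have h3 : fderiv ℝ φ z a = 0 := by simpa [hc] using h1
      simp [h3, metric_eq] at h2
    simp [ha, hc, hd]
  have hsurj := (LinearMap.injective_iff_surjective_of_finrank_eq_finrank
    (by simp [hW])).1 hinj
  obtain ⟨⟨a, c, d⟩, hx⟩ := hsurj w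
  have hd : d = 0 := by
    have := hL (a, c, d)
    rw [hx] at this
    exact this.symm.trans hw
  exact ⟨a, c, by simp [← hx, L, hd]⟩

/-! ### The parallel normal: equations for `r n` and `dr(N)`. -/

/-- The unit normal field is parallel. -/
theorem parallel_normal (h : IsTotallyGeodesicOn m φ N U) (hm : 0 < m)
    (hW : Module.finrank ℝ W = 3) (hz : z ∈ U) (a : W) {w : Ambient} (hw : IsTangent (φ z) w) :
    metric m (φ z) (fderiv ℝ N z a) w
      + christoffel (metric m) (φ z) (fderiv ℝ φ z a) (N z) w = 0 := by
  obtain ⟨b, c, rfl⟩ := h.exists_eq_add hW hz hw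
  have h1 := h.curvature z hz a b
  have h2 := h.curvature_normal hm hz a
  rw [christoffel_metric hm (h.mem_base z hz), metric_eq] at h1 h2 ⊢
  simp only [Prod.fst_add, Prod.snd_add, Prod.smul_fst, Prod.smul_snd, conformalDeriv, radiusDeriv,
      inner_add_right, inner_smul_right, smul_eq_mul] at h1 h2 ⊢
  linear_combination h1 + c * h2

/-- The angular part of `∇N = 0` determines the component tangent to the sphere; the component along
`y` comes from differentiating `⟨y, n⟩ = 0`. -/
theorem fderiv_radius_smul_normal (h : IsTotallyGeodesicOn m φ N U) (hm : 0 < m)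
    (hW : Module.finrank ℝ W = 3) (hz : z ∈ U) (a : W) :
    fderiv ℝ (fun x => radiusAlong m φ x • (N x).2.2) z a
      = -(normalRadiusDeriv m φ N z • (fderiv ℝ φ z a).2.2)
        - inner ℝ (radiusAlong m φ z • (N z).2.2) (fderiv ℝ φ z a).2.2 • (φ z).2.2 := by
  have hr := h.radiusAlong_pos hm hz
  have hd := hasDerivAt_comp_line (h.differentiableAt hz) a
  have hn := hasDerivAt_comp_line (h.differentiableAt_normal hz) a
  have hb : (φ (z + (0 : ℝ) • a)).1 ^ 2 - (φ (z + (0 : ℝ) • a)).2.1 ^ 2 < 1 := by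
    simpa using h.mem_base z hz
  have h1 := ((hd.prod_fst.kruskalRadius hm hd.prod_snd.prod_fst hb).smul
    hn.prod_snd.prod_snd)
  have h2 : DifferentiableAt ℝ (fun x => radiusAlong m φ x • (N x).2.2) z :=
    (h.differentiableAt_radiusAlong hm hz).smul (h.differentiableAt_normal hz).snd.snd
  rw [(hasDerivAt_comp_line h2 a).unique h1]
  simp only [zero_smul, add_zero]
  change radiusAlong m φ z • _ + _ = _
  -- `u` is the difference of the two sides. It is orthogonal to `y`, so `(0, 0, u)` is an
  -- admissible test vector, and testing on it gives `r ⟨u, u⟩ = 0`.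
  set u := radiusAlong m φ z • (fderiv ℝ N z a).2.2
    + radiusDeriv m (φ z).1 (φ z).2.1 (fderiv ℝ φ z a).1 (fderiv ℝ φ z a).2.1 • (N z).2.2
    + normalRadiusDeriv m φ N z • (fderiv ℝ φ z a).2.2
    + inner ℝ (radiusAlong m φ z • (N z).2.2) (fderiv ℝ φ z a).2.2 • (φ z).2.2 with hu
  have hyu : inner ℝ (φ z).2.2 u = 0 := by
    have h3 : inner ℝ (φ z).2.2 (N z).2.2 = 0 := h.tangent z hz
    have h4 : inner ℝ (φ z).2.2 (φ z).2.2 = (1 : ℝ) := by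
      rw [real_inner_self_eq_norm_sq, h.mem_sphere z hz]; norm_num
    simp only [hu, inner_add_right, inner_smul_right, h.inner_deriv hz, h.inner_deriv_normal hz,
      h3, h4, real_inner_smul_left]
    ring
  have huu : inner ℝ u u = 0 := by
    have h3 := h.parallel_normal hm hW hz a (w := (0, 0, u)) hyu
    rw [christoffel_metric hm (h.mem_base z hz), metric_eq] at h3
    simp only [radiusDeriv, conformalDeriv, mul_zero, add_zero, neg_zero, sub_zero, zero_mul,
      zero_add] at h3
    have h5 : radiusAlong m φ z * inner ℝ u u = 0 := by
      nth_rewrite 1 [hu]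
      simp only [inner_add_left, real_inner_smul_left, hyu]
      simp only [normalRadiusDeriv, radiusDeriv, radiusAlong] at h3 ⊢
      linear_combination h3
    exact (mul_eq_zero.1 h5).resolve_left hr.ne'
  have hu0 : u = 0 := inner_self_eq_zero.1 huu
  rw [hu] at hu0
  rw [← sub_eq_zero, ← hu0]
  abel

/-- As `N` is parallel, the left side is `Hess r (a, N)`. The Hessian is `m / r²` times the metric
on the `(T, X)` factor and `r - 2m` times the round metric on the sphere. Orthogonality turns the
first contribution into `-m ⟨n, dy(a)⟩`, whence the factor `r - 3m`. -/
theorem fderiv_normalRadiusDeriv (h : IsTotallyGeodesicOn m φ N U) (hm : 0 < m)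
    (hW : Module.finrank ℝ W = 3) (hz : z ∈ U) (a : W) :
    fderiv ℝ (normalRadiusDeriv m φ N) z a
      = (radiusAlong m φ z - 3 * m) * inner ℝ (N z).2.2 (fderiv ℝ φ z a).2.2 := by
  have hr := h.radiusAlong_pos hm hz
  have hA := conformalFactor_pos hm (h.mem_base z hz)
  have hmul := conformalFactor_mul hm (h.mem_base z hz)
  have hd := hasDerivAt_comp_line (h.differentiableAt hz) a
  have hn := hasDerivAt_comp_line (h.differentiableAt_normal hz) a
  have hb : (φ (z + (0 : ℝ) • a)).1 ^ 2 - (φ (z + (0 : ℝ) • a)).2.1 ^ 2 < 1 := by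
    simpa using h.mem_base z hz
  have h1 := ((hd.prod_fst.conformalFactor hm hd.prod_snd.prod_fst hb).div_const (4 * m)).mul
    ((hd.prod_snd.prod_fst.mul hn.prod_snd.prod_fst).sub (hd.prod_fst.mul hn.prod_fst))
  rw [(hasDerivAt_comp_line (h.differentiableAt_normalRadiusDeriv hm hz) a).unique h1]
  simp only [zero_smul, add_zero, Pi.sub_apply, Pi.mul_apply]
  have hT := h.parallel_normal hm hW hz a (w := (1, 0, 0)) (by simp [IsTangent])
  have hX := h.parallel_normal hm hW hz a (w := (0, 1, 0)) (by simp [IsTangent])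
  have hN := h.normal z hz a
  rw [christoffel_metric hm (h.mem_base z hz), metric_eq] at hT hX
  rw [metric_eq] at hN
  simp only [radiusDeriv, conformalDeriv, inner_zero_right] at hT hX ⊢
  rw [real_inner_comm (N z).2.2] at hT hX
  unfold radiusAlong at hr ⊢
  generalize conformalFactor m (φ z).1 (φ z).2.1 = A at *
  generalize kruskalRadius m (φ z).1 (φ z).2.1 = r at *
  generalize inner ℝ (N z).2.2 (fderiv ℝ φ z a).2.2 = e at *
  generalize (fderiv ℝ φ z a).1 = T' at *
  generalize (fderiv ℝ φ z a).2.1 = X' at *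
  generalize (fderiv ℝ N z a).1 = α' at *
  generalize (fderiv ℝ N z a).2.1 = β' at *
  generalize (N z).1 = α at *
  generalize (N z).2.1 = β at *
  generalize (φ z).1 = T at *
  generalize (φ z).2.1 = X at *
  have hr' := hr.ne'
  have hm' := hm.ne'
  -- The coefficients of `hX` and `hT` are the components of the gradient of `r`; `hN` trades the
  -- `(T, X)` part of the product of `N` and `a` for the angular one, and `hmul` evaluates `|∇r|²`.
  linear_combination (norm := skip) X / (4 * m) * hX + T / (4 * m) * hT
    + (1 / (4 * m) * (1 - 1 / 2 * (1 / r + 1 / (2 * m)) * (A / (4 * m)) * (X ^ 2 - T ^ 2))) * hN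
    + (e / (16 * m ^ 2) * (1 / 2 * (1 / r + 1 / (2 * m)) * r + 1)) * hmul
  field_simp
  ring

/-! ### The integrability condition and its consequences. -/

/-- The projection of the tangent space to the sphere is surjective. -/
theorem exists_fderiv_eq (h : IsTotallyGeodesicOn m φ N U) (hm : 0 < m)
    (hW : Module.finrank ℝ W = 3) (hz : z ∈ U) {v : EuclideanSpace ℝ (Fin 3)}
    (hv : inner ℝ (φ z).2.2 v = 0) : ∃ a, (fderiv ℝ φ z a).2.2 = v := by
  have hA := (conformalFactor_pos hm (h.mem_base z hz)).ne'
  have hα := h.normal_fst_ne_zero hm hz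
  -- A lift of `v` whose `T`-component is chosen to make it orthogonal to `N`; it is then tangent to
  -- the hypersurface.
  set w : Ambient := (kruskalRadius m (φ z).1 (φ z).2.1 ^ 2 * inner ℝ (N z).2.2 v
    / (conformalFactor m (φ z).1 (φ z).2.1 * (N z).1), 0, v) with hw
  have hNw : metric m (φ z) (N z) w = 0 := by
    rw [metric_eq, hw]
    field_simp
    ring
  obtain ⟨a, c, hac⟩ := h.exists_eq_add hW hz (w := w) hv
  have hc : c = 0 := by
    have h1 := h.unit z hz
    have h2 := h.normal z hz a
    rw [hac] at hNw
    simp only [metric_eq, Prod.fst_add, Prod.snd_add, Prod.smul_fst, Prod.smul_snd,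
      inner_add_right, inner_smul_right, smul_eq_mul] at h1 h2 hNw
    linear_combination h2 + c * h1 - hNw
  refine ⟨a, ?_⟩
  rw [hc, zero_smul, add_zero] at hac
  rw [← hac]

/-- The angular part of the Codazzi equation. -/
theorem inner_smul_comm (h : IsTotallyGeodesicOn m φ N U) (hm : 0 < m)
    (hW : Module.finrank ℝ W = 3) (hz : z ∈ U) (a b : W) :
    inner ℝ (N z).2.2 (fderiv ℝ φ z a).2.2 • (fderiv ℝ φ z b).2.2
      = inner ℝ (N z).2.2 (fderiv ℝ φ z b).2.2 • (fderiv ℝ φ z a).2.2 := by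
  set f := normalRadiusDeriv m φ N with hf
  set q : W → (EuclideanSpace ℝ (Fin 3)) := fun x => radiusAlong m φ x • (N x).2.2 with hq
  set y : W → (EuclideanSpace ℝ (Fin 3)) := fun x => (φ x).2.2 with hy
  set P : Ambient →L[ℝ] (EuclideanSpace ℝ (Fin 3)) := (ContinuousLinearMap.snd ℝ ℝ (EuclideanSpace ℝ (Fin 3))).comp (ContinuousLinearMap.snd ℝ ℝ _)
    with hP
  set D : W → W →L[ℝ] (EuclideanSpace ℝ (Fin 3)) := fun x => P.comp (fderiv ℝ φ x) with hD
  have hyd : ∀ x ∈ U, HasFDerivAt y (D x) x := fun x hx =>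
    P.hasFDerivAt.comp x (h.differentiableAt hx).hasFDerivAt
  have hqd : ∀ x ∈ U, DifferentiableAt ℝ q x := fun x hx =>
    (h.differentiableAt_radiusAlong hm hx).smul (h.differentiableAt_normal hx).snd.snd
  have hDd : DifferentiableAt ℝ D z :=
    (differentiableAt_const P).clm_comp (h.differentiableAt_fderiv hz)
  have hfd : DifferentiableAt ℝ f z := h.differentiableAt_normalRadiusDeriv hm hz
  set Q : W → W →L[ℝ] (EuclideanSpace ℝ (Fin 3)) := fun x => -(f x • D x)
    - ((innerSL ℝ (q x)).comp (D x)).smulRight (y x) with hQ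
  have hqQ : ∀ x ∈ U, HasFDerivAt q (Q x) x := by
    intro x hx
    convert (hqd x hx).hasFDerivAt using 1
    ext1 c
    rw [h.fderiv_radius_smul_normal hm hW hx c]
    rfl
  have hsymm_y := second_derivative_symmetric_of_eventually
    (Filter.eventually_of_mem (h.isOpen.mem_nhds hz) hyd) hDd.hasFDerivAt a b
  have hydz := (hyd z hz).differentiableAt
  have hqdz := hqd z hz
  have hQd : DifferentiableAt ℝ Q z := by
    have h1 : DifferentiableAt ℝ (fun x => (innerSL ℝ (q x)).comp (D x)) z :=
      ((innerSL ℝ).differentiableAt.comp z hqdz).clm_comp hDd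
    have h2 : DifferentiableAt ℝ (fun x => ((innerSL ℝ (q x)).comp (D x)).smulRight (y x)) z :=
      DifferentiableAt.comp
        (g := fun p : (W →L[ℝ] ℝ) × EuclideanSpace ℝ (Fin 3) => p.1.smulRight p.2) z
        (isBoundedBilinearMap_smulRight.differentiableAt _) (h1.prodMk hydz)
    exact ((hfd.smul hDd).neg).sub h2
  have hsymm_q := second_derivative_symmetric_of_eventually
    (Filter.eventually_of_mem (h.isOpen.mem_nhds hz) hqQ) hQd.hasFDerivAt a b
  have hQc : ∀ a b : W, fderiv ℝ Q z a b = -(fderiv ℝ f z a • D z b + f z • fderiv ℝ D z a b)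
      - ((inner ℝ (Q z a) (D z b) + inner ℝ (q z) (fderiv ℝ D z a b)) • y z
        + inner ℝ (q z) (D z b) • D z a) := by
    intro a b
    have hDl : HasDerivAt (fun t : ℝ => D (z + t • a) b) (fderiv ℝ D z a b) 0 := by
      simpa using (hasDerivAt_comp_line hDd a).clm_apply (hasDerivAt_const (0 : ℝ) b)
    have hQl : HasDerivAt (fun t : ℝ => Q (z + t • a) b) (fderiv ℝ Q z a b) 0 := by
      simpa using (hasDerivAt_comp_line hQd a).clm_apply (hasDerivAt_const (0 : ℝ) b)
    have hfl := hasDerivAt_comp_line hfd a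
    have hql := hasDerivAt_comp_line hqdz a
    have hyl := hasDerivAt_comp_line hydz a
    rw [(hyd z hz).fderiv] at hyl
    rw [(hqQ z hz).fderiv] at hql
    have := hQl.unique (((hfl.smul hDl).neg).sub ((hql.inner ℝ hDl).smul hyl))
    rw [this]
    simp only [zero_smul, add_zero]
    module
  have hyD : ∀ c, inner ℝ (y z) (D z c) = 0 := fun c => h.inner_deriv hz c
  -- The `y` term of `Q` is orthogonal to the range of `D`, so the pairing reduces to the symmetric
  -- form `-f ⟨D a, D b⟩`.
  have hQD : inner ℝ (Q z a) (D z b) = inner ℝ (Q z b) (D z a) := by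
    have : ∀ c, Q z c = -(f z • D z c) - inner ℝ (q z) (D z c) • y z := fun c => rfl
    simp only [this, inner_sub_left, inner_neg_left, real_inner_smul_left, hyD, mul_zero]
    rw [real_inner_comm]
  have hr := h.radiusAlong_pos hm hz
  have hfv : ∀ c, fderiv ℝ f z c = (radiusAlong m φ z - 3 * m) * inner ℝ (N z).2.2 (D z c) :=
    fun c => h.fderiv_normalRadiusDeriv hm hW hz c
  have hqv : ∀ c, inner ℝ (q z) (D z c) = radiusAlong m φ z * inner ℝ (N z).2.2 (D z c) :=
    fun c => real_inner_smul_left _ _ _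
  rw [hQc a b, hQc b a, hsymm_y, hQD, hfv, hfv, hqv, hqv] at hsymm_q
  change inner ℝ (N z).2.2 (D z a) • D z b = inner ℝ (N z).2.2 (D z b) • D z a
  -- After antisymmetrisation, `df` contributes the factor `r - 3m` and `r n` the factor `r` with
  -- opposite sign; only `3m` survives.
  have h3 : (3 * m) • (inner ℝ (N z).2.2 (D z a) • D z b)
      = (3 * m) • (inner ℝ (N z).2.2 (D z b) • D z a) := by
    rw [← sub_eq_zero] at hsymm_q ⊢
    rw [← hsymm_q]
    module
  exact smul_right_injective (EuclideanSpace ℝ (Fin 3)) (by positivity : (3 * m) ≠ 0) h3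

/-- Choose `a` with `dy(a) = n` and `b` with `dy(b) ≠ 0` orthogonal to `n`: the integrability
condition becomes `|n|² dy(b) = 0`. -/
theorem normal_angular_eq_zero (h : IsTotallyGeodesicOn m φ N U) (hm : 0 < m)
    (hW : Module.finrank ℝ W = 3) (hz : z ∈ U) : (N z).2.2 = 0 := by
  obtain ⟨v, hv0, hyv, hnv⟩ := EuclideanSpace.exists_ne_zero_inner_eq_zero (φ z).2.2 (N z).2.2
  obtain ⟨a, ha⟩ := h.exists_fderiv_eq hm hW hz (h.tangent z hz)
  obtain ⟨b, hb⟩ := h.exists_fderiv_eq hm hW hz hyv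
  have := h.inner_smul_comm hm hW hz a b
  rw [ha, hb, hnv, zero_smul] at this
  exact inner_self_eq_zero.1 ((smul_eq_zero.1 this).resolve_right hv0)

/-- With `n = 0` on an open set, the equation for `d(r n)` reduces to `f dy = 0`, and `dy` is not
zero. -/
theorem normalRadiusDeriv_eq_zero (h : IsTotallyGeodesicOn m φ N U) (hm : 0 < m)
    (hW : Module.finrank ℝ W = 3) (hz : z ∈ U) : normalRadiusDeriv m φ N z = 0 := by
  obtain ⟨v, hv0, hyv, -⟩ := EuclideanSpace.exists_ne_zero_inner_eq_zero (φ z).2.2 (N z).2.2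
  obtain ⟨a, ha⟩ := h.exists_fderiv_eq hm hW hz hyv
  have h1 := h.fderiv_radius_smul_normal hm hW hz a
  have h2 : (fun x => radiusAlong m φ x • (N x).2.2) =ᶠ[𝓝 z] fun _ => 0 := by
    filter_upwards [h.isOpen.mem_nhds hz] with x hx
    rw [h.normal_angular_eq_zero hm hW hx, smul_zero]
  rw [h2.fderiv_eq, h.normal_angular_eq_zero hm hW hz, ha] at h1
  simp only [fderiv_fun_const, Pi.zero_apply, zero_apply, smul_zero,
    inner_zero_left, zero_smul, sub_zero, zero_eq_neg] at h1
  exact (smul_eq_zero.1 h1).resolve_right hv0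

/-- The quotient `T / X` is stationary along a totally geodesic hypersurface. -/
theorem mul_fderiv_eq_mul_fderiv (h : IsTotallyGeodesicOn m φ N U) (hm : 0 < m)
    (hW : Module.finrank ℝ W = 3) (hz : z ∈ U) (a : W) :
    (φ z).2.1 * (fderiv ℝ φ z a).1 = (φ z).1 * (fderiv ℝ φ z a).2.1 := by
  have hA := (conformalFactor_pos hm (h.mem_base z hz)).ne'
  have h1 := h.normalRadiusDeriv_eq_zero hm hW hz
  have h2 := h.normal z hz a
  have h3 : (φ z).2.1 * (N z).2.1 - (φ z).1 * (N z).1 = 0 :=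
    (mul_eq_zero.1 h1).resolve_left (div_ne_zero hA (by positivity))
  rw [metric_eq, h.normal_angular_eq_zero hm hW hz, inner_zero_left, mul_zero, add_zero] at h2
  have h4 := (mul_eq_zero.1 h2).resolve_left hA
  refine mul_left_cancel₀ (h.normal_fst_ne_zero hm hz) ?_
  -- Both `(T, X)` and the tangent projection `(T', X')` are Lorentz-orthogonal to the `(T, X)` part
  -- of `N`, hence proportional.
  linear_combination -(φ z).2.1 * h4 + (fderiv ℝ φ z a).2.1 * h3

end IsTotallyGeodesicOn

/-! ### From charts to a global static slice. -/

section Hypersurface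

variable {S : Type*} [TopologicalSpace S] [ChartedSpace (EuclideanSpace ℝ (Fin 3)) S]
  [IsManifold (𝓡 3) ω S]

theorem _root_.fderiv_comp_extChartAt_symm {F : Type*} [NormedAddCommGroup F] [NormedSpace ℝ F]
    {f : S → F} (hf : ContMDiff (𝓡 3) 𝓘(ℝ, F) ω f) (x₀ : S) {z : EuclideanSpace ℝ (Fin 3)}
    (hz : z ∈ (extChartAt (𝓡 3) x₀).target) (a : EuclideanSpace ℝ (Fin 3)) :
    fderiv ℝ (f ∘ (extChartAt (𝓡 3) x₀).symm) z a
      = mvfderiv (𝓡 3) f ((extChartAt (𝓡 3) x₀).symm z)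
        (mfderiv 𝓘(ℝ, EuclideanSpace ℝ (Fin 3)) (𝓡 3) (extChartAt (𝓡 3) x₀).symm z a) := by
  have h1 : MDifferentiableAt 𝓘(ℝ, EuclideanSpace ℝ (Fin 3)) (𝓡 3)
      (extChartAt (𝓡 3) x₀).symm z :=
    ((contMDiffOn_extChartAt_symm (n := ω) x₀).contMDiffAt
      ((isOpen_extChartAt_target x₀).mem_nhds hz)).mdifferentiableAt (by simp)
  have h2 : MDifferentiableAt (𝓡 3) 𝓘(ℝ, F) f ((extChartAt (𝓡 3) x₀).symm z) :=
    (hf _).mdifferentiableAt (by simp)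
  rw [← mfderiv_eq_fderiv, mfderiv_comp z h2 h1]
  rfl

theorem _root_.injective_mfderiv_extChartAt_symm (x₀ : S) {z : EuclideanSpace ℝ (Fin 3)}
    (hz : z ∈ (extChartAt (𝓡 3) x₀).target) :
    Function.Injective
      (mfderiv 𝓘(ℝ, EuclideanSpace ℝ (Fin 3)) (𝓡 3) (extChartAt (𝓡 3) x₀).symm z) := by
  have h := mfderiv_extChartAt_comp_mfderivWithin_extChartAt_symm (I := 𝓡 3) hz
  rw [ModelWithCorners.range_eq_univ, mfderivWithin_univ] at h
  intro a b hab
  have := congrArg (mfderiv (𝓡 3) 𝓘(ℝ, EuclideanSpace ℝ (Fin 3)) (extChartAt (𝓡 3) x₀)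
    ((extChartAt (𝓡 3) x₀).symm z)) hab
  have ha := DFunLike.congr_fun h a
  have hb := DFunLike.congr_fun h b
  exact ha.symm.trans (this.trans hb)

/-- A time-symmetric hypersurface is totally geodesic in every chart. -/
theorem isTotallyGeodesicOn_extChartAt {m : ℝ} {ι : S → Spacetime} {N : S → Ambient}
    (hι : IsAnalyticEmbedding ι) (hs : IsSpacelike m ι) (hN : IsUnitNormal m ι N)
    (hK : ∀ (x : S) (a b : TangentSpace (𝓡 3) x),
      extrinsicCurvature (metric m) (fun y => (ι y : Ambient)) N x a b = 0) (x₀ : S) :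
    IsTotallyGeodesicOn m ((fun x => (ι x : Ambient)) ∘ (extChartAt (𝓡 3) x₀).symm)
      (N ∘ (extChartAt (𝓡 3) x₀).symm) (extChartAt (𝓡 3) x₀).target := by
  have hι' := hι.contMDiff
  have hsymm := contMDiffOn_extChartAt_symm (I := 𝓡 3) (n := ω) x₀
  refine ⟨isOpen_extChartAt_target x₀, ?_, ?_, fun z _ => (ι _).2.1, fun z _ => (ι _).2.2,
    fun z _ => hN.tangent _, fun z _ => hN.unit _, ?_, ?_, ?_⟩
  · exact (hι'.comp_contMDiffOn hsymm).contDiffOn.of_le le_top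
  · exact (hN.analytic.comp_contMDiffOn hsymm).contDiffOn.of_le le_top
  · intro z hz a
    rw [fderiv_comp_extChartAt_symm hι' x₀ hz]
    exact hN.normal _ _
  · intro z hz a ha
    rw [fderiv_comp_extChartAt_symm hι' x₀ hz]
    exact hs _ _ fun h0 => ha (injective_mfderiv_extChartAt_symm x₀ hz (h0.trans (map_zero _).symm))
  · intro z hz a b
    rw [fderiv_comp_extChartAt_symm hι' x₀ hz, fderiv_comp_extChartAt_symm hι' x₀ hz,
      fderiv_comp_extChartAt_symm hN.analytic x₀ hz]
    exact hK _ _ _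

/-- A time-symmetric hypersurface of an exterior region lies in a static slice `T = c X`. -/
theorem exists_fst_eq_mul {m : ℝ} (hm : 0 < m) [ConnectedSpace S] {ι : S → Spacetime}
    (hι : IsAnalyticEmbedding ι) (hX : ∀ x, (ι x).1.2.1 ≠ 0) (hsym : IsTimeSymmetric m ι) :
    ∃ c : ℝ, ∀ x, (ι x).1.1 = c * (ι x).1.2.1 := by
  obtain ⟨hs, N, hN, hK⟩ := hsym
  have hloc : IsLocallyConstant fun x => (ι x).1.1 / (ι x).1.2.1 := by
    rw [IsLocallyConstant.iff_eventually_eq]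
    intro x₀
    have hgeo := isTotallyGeodesicOn_extChartAt hι hs hN hK x₀
    set e := extChartAt (𝓡 3) x₀ with he
    set φ : EuclideanSpace ℝ (Fin 3) → Ambient := (fun x => (ι x : Ambient)) ∘ e.symm with hφ
    obtain ⟨ε, hε, hball⟩ := Metric.isOpen_iff.1 hgeo.isOpen (e x₀) (mem_extChartAt_target x₀)
    have hd : ∀ z ∈ Metric.ball (e x₀) ε, HasFDerivAt (fun z => (φ z).1 / (φ z).2.1)
        (0 : EuclideanSpace ℝ (Fin 3) →L[ℝ] ℝ) z := by
      intro z hz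
      have hzX : (φ z).2.1 ≠ 0 := hX _
      have h1 := hgeo.differentiableAt (hball hz)
      have h2 : DifferentiableAt ℝ (fun z => (φ z).1 / (φ z).2.1) z := by
        simp only [div_eq_mul_inv]
        exact h1.fst.mul (h1.snd.fst.inv hzX)
      convert h2.hasFDerivAt using 1
      ext1 a
      have h3 := hasDerivAt_comp_line h1 a
      -- The numerator in the quotient rule is `X dT - T dX`, which vanishes.
      have h4 := (hasDerivAt_comp_line h2 a).unique
        (h3.prod_fst.div h3.prod_snd.prod_fst (by simpa using hzX))
      have h5 := hgeo.mul_fderiv_eq_mul_fderiv hm (by simp) (hball hz) a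
      rw [h4]
      simp only [zero_smul, add_zero, zero_apply]
      rw [mul_comm, h5, sub_self, zero_div]
    have hconst : ∀ z ∈ Metric.ball (e x₀) ε,
        (φ z).1 / (φ z).2.1 = (φ (e x₀)).1 / (φ (e x₀)).2.1 := fun z hz =>
      (convex_ball (e x₀) ε).is_const_of_fderivWithin_eq_zero
        (fun w hw => (hd w hw).differentiableAt.differentiableWithinAt)
        (fun w hw => by rw [fderivWithin_of_isOpen Metric.isOpen_ball hw, (hd w hw).fderiv])
        hz (Metric.mem_ball_self hε)
    have h1 : ∀ᶠ x in 𝓝 x₀, e x ∈ Metric.ball (e x₀) ε :=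
      (continuousAt_extChartAt x₀).eventually_mem (Metric.ball_mem_nhds _ hε)
    filter_upwards [h1, extChartAt_source_mem_nhds (I := 𝓡 3) x₀] with x hx hxs
    have := hconst _ hx
    simpa only [hφ, Function.comp_apply, he, (extChartAt (𝓡 3) x₀).left_inv hxs,
      extChartAt_to_inv] using this
  obtain ⟨x₁⟩ : Nonempty S := inferInstance
  refine ⟨(ι x₁).1.1 / (ι x₁).1.2.1, fun x => ?_⟩
  rw [← hloc.apply_eq_of_preconnectedSpace x x₁]
  exact (div_mul_cancel₀ _ (hX x)).symm

end Hypersurface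

end Kruskal

/-! ### The boundary and the horizon. -/

theorem corollary2 (m : ℝ) (hm : 0 < m)
    {S : Type*} [TopologicalSpace S] [ChartedSpace (EuclideanSpace ℝ (Fin 3)) S]
    [IsManifold (𝓡 3) ω S] [ConnectedSpace S]
    (ι : S → Kruskal.Spacetime) (hι : Kruskal.IsAnalyticEmbedding ι)
    (hext : Set.range ι ⊆ Kruskal.exterior₁ ∨ Set.range ι ⊆ Kruskal.exterior₂)
    (hsym : Kruskal.IsTimeSymmetric m ι)
    (p : Kruskal.Spacetime) (hp : p ∈ Kruskal.eventHorizon \ Kruskal.bifurcationSphere) :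
    p ∉ frontier (Set.range ι) := by
  intro hpf
  have habs : ∀ x, |(ι x).1.1| < |(ι x).1.2.1| := by
    intro x
    rcases hext with h | h
    · exact lt_of_lt_of_le (h ⟨x, rfl⟩) (le_abs_self _)
    · have h1 : (ι x).1.2.1 < -|(ι x).1.1| := h ⟨x, rfl⟩
      exact lt_of_lt_of_le (lt_neg.1 h1) (neg_le_abs _)
  have hX : ∀ x, (ι x).1.2.1 ≠ 0 := fun x =>
    abs_pos.1 ((abs_nonneg _).trans_lt (habs x))
  obtain ⟨c, hc⟩ := Kruskal.exists_fst_eq_mul hm hι hX hsym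
  obtain ⟨x₁⟩ : Nonempty S := inferInstance
  -- One point of the hypersurface suffices, since `c` is global.
  have hc1 : |c| < 1 := by
    have h1 := habs x₁
    rw [hc, abs_mul] at h1
    exact (mul_lt_iff_lt_one_left (abs_pos.2 (hX x₁))).1 h1
  have hclosed : IsClosed {q : Kruskal.Spacetime | q.1.1 = c * q.1.2.1} :=
    isClosed_eq (by fun_prop) (by fun_prop)
  have hpc : p.1.1 = c * p.1.2.1 :=
    hclosed.closure_subset_iff.2 (by rintro _ ⟨x, rfl⟩; exact hc x) (frontier_subset_closure hpf)
  have hpabs : |p.1.1| = |p.1.2.1| := by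
    rcases hp.1 with h | h
    · rw [show p.1.1 = |p.1.2.1| from h, abs_abs]
    · rw [show p.1.1 = -|p.1.2.1| from h, abs_neg, abs_abs]
  have hX0 : p.1.2.1 = 0 := by
    by_contra h0
    rw [hpc, abs_mul] at hpabs
    exact hc1.ne ((mul_eq_right₀ (abs_pos.2 h0).ne').1 hpabs)
  refine hp.2 ⟨?_, ?_⟩
  · change p.1.1 = |p.1.2.1|
    rw [hpc, hX0, mul_zero, abs_zero]
  · change p.1.1 = -|p.1.2.1|
    rw [hpc, hX0, mul_zero, abs_zero, neg_zero]
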